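/- Let $H,r,N$ be integers with $1\le r\le H$ and $N\ge 1$, and let $K=\binom{H}{r}$. In the $(H,r,M,N)$ combination network, a server holds $N$ files $F_1,\dots,F_N$ of $B$ i.i.d. uniformly distributed bits each and is connected to $H$ relays without caches; there are $K$ users, one for each set of $r$ relays, and each user is connected to exactly the relays in its set. All links are error-free and orthogonal. A scheme for file length $B$ consists of the following (arbitrary, possibly coded) maps. In the placement phase each user $k$ stores a function $Z_k$ of the $N$ files, of at most $MB$ bits. Then a demand vector $\mathbf d=(d_1,\dots,d_K)\in\{1,\dots,N\}^K$ is revealed to all nodes; the server sends to each relay $h$ a message $X_h$ that is a function of the files and $\mathbf d$; each relay $h$ sends to each user $k$ connected to it a message $X_{h\to k}$ that is a function of $X_h$ and $\mathbf d$; and each user $k$ computes an estimate of $F_{d_k}$ from $\mathbf d$, $Z_k$ and the messages $X_{h\to k}$ received from the relays connected to it. A max-link load $R$ is achievable with cache size $M$ if there are schemes, one for each $B$, such that for every $\mathbf d$ every message $X_h$ and every message $X_{h\to k}$ has at most $RB$ bits and the probability that some user's estimate is wrong tends to $0$ as $B\to\infty$. The optimal max-link load $R^\star$ is the infimum of the achievable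 max-link loads. Then for every real $M$ with $$\frac{(K-H+r-1)N}{K}\le M\le N$$ one has $$R^\star=\frac{1-M/N}{r}.$$ -/

import Mathlib

namespace CombinationNetwork

/-- Strings of `n` bits. -/
abbrev Bits (n : ℕ) : Type := Fin n → Bool

/-- The users of the combination network with `H` relays: exactly one user for each set of `r`
relays, the user being identified with the set of relays it is connected to. -/
abbrev User (H r : ℕ) : Type := {s : Finset (Fin H) // s.card = r}

/-- The relays to which the user `k` is connected. -/
abbrev RelayOf {H r : ℕ} (k : User H r) : Type := {h : Fin H // h ∈ k.1}

/-- A library: `N` files of `B` bits each. -/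
abbrev Library (N B : ℕ) : Type := Fin N → Bits B

/-- A demand vector: each user requests one of the `N` files. -/
abbrev Demand (H r N : ℕ) : Type := User H r → Fin N

/-- A caching scheme for files of `B` bits. The placement does not depend on the demands;
everything in the delivery phase may depend on the demand vector `d`, which all nodes know.
All maps are otherwise arbitrary, so coded placement and coded delivery are allowed. -/
structure Scheme (H r N B : ℕ) where
  /-- number of bits stored in the cache of user `k` -/
  cacheLen : User H r → ℕ
  /-- cache content `Z_k`, a function of the library -/
  cache : (k : User H r) → Library N B → Bits (cacheLen k)
  /-- number of bits sent by the server to relay `h` -/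
  serverLen : Demand H r N → Fin H → ℕ
  /-- message `X_h` from the server to relay `h` -/
  serverMsg : (d : Demand H r N) → (h : Fin H) → Library N B → Bits (serverLen d h)
  /-- number of bits sent by relay `h` to the connected user `k` -/
  relayLen : Demand H r N → (k : User H r) → RelayOf k → ℕ
  /-- message from relay `h` to the connected user `k`, computed from what the relay received -/
  relayMsg : (d : Demand H r N) → (k : User H r) → (h : RelayOf k) →
    Bits (serverLen d h.1) → Bits (relayLen d k h)
  /-- the estimate of the requested file that user `k` computes from its cache and from the
  messages of the relays to which it is connected -/
  decode : (d : Demand H r N) → (k : User H r) → Bits (cacheLen k) →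
    ((h : RelayOf k) → Bits (relayLen d k h)) → Bits B

namespace Scheme

variable {H r N B : ℕ}

/-- The file that user `k` reconstructs under demand `d` when the library is `F`. -/
def output (S : Scheme H r N B) (d : Demand H r N) (F : Library N B) (k : User H r) : Bits B :=
  S.decode d k (S.cache k F) (fun h => S.relayMsg d k h (S.serverMsg d h.1 F))

open Classical in
/-- The probability, over a uniformly distributed library (that is, all bits of all files are
i.i.d. uniform), that some user fails to recover its requested file under demand `d`. -/
noncomputable def errorProb (S : Scheme H r N B) (d : Demand H r N) : ℝ :=
  ((Finset.univ.filter fun F : Library N B => ∃ k, S.output d F k ≠ F (d k)).card : ℝ) /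
    (Fintype.card (Library N B) : ℝ)

/-- Every user's cache holds at most `M * B` bits. -/
def CacheAtMost (S : Scheme H r N B) (M : ℝ) : Prop :=
  ∀ k, (S.cacheLen k : ℝ) ≤ M * B

/-- For every demand, every link (from the server to a relay, or from a relay to a user)
carries at most `R * B` bits. -/
def MaxLinkLoadAtMost (S : Scheme H r N B) (R : ℝ) : Prop :=
  ∀ d : Demand H r N,
    (∀ h, (S.serverLen d h : ℝ) ≤ R * B) ∧
    (∀ (k : User H r) (h : RelayOf k), (S.relayLen d k h : ℝ) ≤ R * B)

end Scheme

/-- The max-link load `R` is achievable with cache size `M` (measured in files): there are schemes,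
one for each file length `B`, that respect the cache size and the load, and whose error
probability tends to `0` as `B → ∞`, for every demand vector. -/
def Achievable (H r N : ℕ) (M R : ℝ) : Prop :=
  ∃ S : (B : ℕ) → Scheme H r N B,
    (∀ B, (S B).CacheAtMost M) ∧
    (∀ B, (S B).MaxLinkLoadAtMost R) ∧
    ∀ d : Demand H r N,
      Filter.Tendsto (fun B => (S B).errorProb d) Filter.atTop (nhds 0)

/-- `R` is the optimal max-link load with cache size `M`: the infimum of the achievable max-link
loads. (The set of reals without elements has no greatest lower bound, so this includes that
some load is achievable.) -/
def IsOptimalMaxLinkLoad (H r N : ℕ) (M R : ℝ) : Prop :=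
  IsGLB {R' : ℝ | Achievable H r N M R'} R

end CombinationNetwork

namespace CombinationNetwork

/-! Write `r = q + 1` and `u = 1 - M / N`. For the upper bound, label pieces of each file by the
`q`-sets `T` of relays, and let user `k` cache every piece with `T ⊄ k`. It lacks only the pieces `k
\ {h}`, `h ∈ k`, and relay `h` forwards the xor over all users `k ∋ h` of piece `k \ {h}` of the
file that `k` wants. Each other term is cached by `k` (`coded_determines`), so load about `u / r`
suffices. Pieces of length about `u * B / r` fit into a file when `u * H.choose q ≤ r`, which is the
assumption on `M`; the rest of the file is cached by everybody, up to rounding (`achievable_of_lt`).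
For the lower bound, one user faced with the `N` constant demands learns all files from one cache
and `N * r` relay messages (`Achievable.cut_set`). -/

/-- Bit strings indexed by an arbitrary finite type, as strings of bits. -/
noncomputable def packBits {ι : Type} [Fintype ι] : (ι → Bool) ≃ Bits (Fintype.card ι) :=
  (Fintype.equivFin ι).arrowCongr (Equiv.refl Bool)

open Classical in
/-- The scheme with the given cache contents and server messages in which the relays forward
everything they receive and every user outputs the file of some library that is consistent with
what it sees. -/
noncomputable def Scheme.ofForwarding {H r N B : ℕ} {ι : User H r → Type} [∀ k, Fintype (ι k)]
    {κ : Type} [Fintype κ] (cache : (k : User H r) → Library N B → ι k → Bool)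
    (msg : Demand H r N → Fin H → Library N B → κ → Bool) : Scheme H r N B where
  cacheLen k := Fintype.card (ι k)
  cache k F := packBits (cache k F)
  serverLen _ _ := Fintype.card κ
  serverMsg d h F := packBits (msg d h F)
  relayLen _ _ _ := Fintype.card κ
  relayMsg _ _ _ x := x
  decode d k z m :=
    if hF : ∃ F : Library N B, packBits (cache k F) = z ∧
        ∀ h : RelayOf k, packBits (msg d h.1 F) = m h
    then hF.choose (d k) else fun _ => false

/-- Reduces correct decoding to an injectivity statement, so no decoder has to be written down. -/
theorem Scheme.ofForwarding_output {H r N B : ℕ} {ι : User H r → Type} [∀ k, Fintype (ι k)]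
    {κ : Type} [Fintype κ] (cache : (k : User H r) → Library N B → ι k → Bool)
    (msg : Demand H r N → Fin H → Library N B → κ → Bool) (d : Demand H r N) (k : User H r)
    (hdet : ∀ F F' : Library N B, cache k F = cache k F' →
      (∀ h ∈ k.1, msg d h F = msg d h F') → F (d k) = F' (d k)) (F : Library N B) :
    (Scheme.ofForwarding cache msg).output d F k = F (d k) := by
  have hF : ∃ F' : Library N B, packBits (cache k F') = packBits (cache k F) ∧
      ∀ h : RelayOf k, packBits (msg d h.1 F') = packBits (msg d h.1 F) := ⟨F, rfl, fun _ => rfl⟩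
  have hout : (Scheme.ofForwarding cache msg).output d F k = hF.choose (d k) := dif_pos hF
  rw [hout]
  exact hdet _ _ (packBits.injective hF.choose_spec.1)
    fun h hh => packBits.injective (hF.choose_spec.2 ⟨h, hh⟩)

theorem Scheme.errorProb_eq_zero {H r N B : ℕ} (S : Scheme H r N B) (d : Demand H r N)
    (h : ∀ F k, S.output d F k = F (d k)) : S.errorProb d = 0 := by
  simp [Scheme.errorProb, h]

/-- The set of relays of a user with one relay removed. -/
def User.erase {H q : ℕ} (k : User H (q + 1)) (h : Fin H) (hk : h ∈ k.1) : User H q :=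
  ⟨k.1.erase h, by rw [Finset.card_erase_of_mem hk, k.2]; rfl⟩

/-- A bit as an element of the field with two elements. -/
def bitToZMod (b : Bool) : ZMod 2 := if b then 1 else 0

theorem bitToZMod_injective : Function.Injective bitToZMod := by
  unfold Function.Injective bitToZMod; decide

/-- An element of the field with two elements as a bit. -/
def zmodToBit (x : ZMod 2) : Bool := decide (x = 1)

theorem zmodToBit_injective : Function.Injective zmodToBit := by
  unfold Function.Injective zmodToBit; decide

/-! ### Coded placement-and-delivery scheme -/

section CodedDelivery

variable {H q N B a s c : ℕ} (e : Fin B ≃ (User H q × Fin a) ⊕ (Fin s ⊕ Fin c))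

/-- The positions cached by user `k`: those in pieces labelled by `q`-sets of relays that are not
all connected to `k`, and those in the part that everybody caches. -/
abbrev CachedPos (a c : ℕ) (k : User H (q + 1)) : Type :=
  ({T : User H q // ¬ T.1 ⊆ k.1} × Fin a) ⊕ Fin c

/-- The position in the file of a cached position. -/
def cachedPos (k : User H (q + 1)) : CachedPos a c k → Fin B
  | .inl p => e.symm (.inl (p.1.1, p.2))
  | .inr i => e.symm (.inr (.inr i))

/-- The cache of user `k`. -/
def codedCache (k : User H (q + 1)) (F : Library N B) (p : Fin N × CachedPos a c k) : Bool :=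
  F p.1 (cachedPos e k p.2)

/-- The contribution of user `k` to the coded message sent to relay `h`. -/
def codedTerm (d : Demand H (q + 1) N) (h : Fin H) (F : Library N B) (i : Fin a)
    (k : User H (q + 1)) : ZMod 2 :=
  if hk : h ∈ k.1 then bitToZMod (F (d k) (e.symm (.inl (k.erase h hk, i)))) else 0

/-- The message sent to relay `h`: the exclusive or of one missing piece for each connected user,
and the part of every file that nobody caches. -/
def codedMsg (d : Demand H (q + 1) N) (h : Fin H) (F : Library N B) :
    Fin a ⊕ (Fin N × Fin s) → Bool
  | .inl i => zmodToBit (∑ k, codedTerm e d h F i k)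
  | .inr p => F p.1 (e.symm (.inr (.inl p.2)))

theorem coded_determines (d : Demand H (q + 1) N) (k : User H (q + 1)) (F F' : Library N B)
    (hc : codedCache e k F = codedCache e k F')
    (hm : ∀ h ∈ k.1, codedMsg e d h F = codedMsg e d h F') : F (d k) = F' (d k) := by
  have hc1 : ∀ n (T : User H q), ¬ T.1 ⊆ k.1 → ∀ i,
      F n (e.symm (.inl (T, i))) = F' n (e.symm (.inl (T, i))) := fun n T hT i =>
    congrFun hc (n, .inl (⟨T, hT⟩, i))
  have hc2 : ∀ n i, F n (e.symm (.inr (.inr i))) = F' n (e.symm (.inr (.inr i))) := fun n i =>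
    congrFun hc (n, .inr i)
  funext j
  obtain ⟨p, rfl⟩ := e.symm.surjective j
  rcases p with ⟨T, i⟩ | i | i
  · by_cases hT : T.1 ⊆ k.1
    · have hcard : (k.1 \ T.1).card = 1 := by
        rw [Finset.card_sdiff_of_subset hT, k.2, T.2]; omega
      obtain ⟨h, hh⟩ := Finset.card_eq_one.1 hcard
      have hmem : h ∈ k.1 \ T.1 := by simp [hh]
      have hk : h ∈ k.1 := (Finset.mem_sdiff.1 hmem).1
      have hTk : k.erase h hk = T := by
        apply Subtype.ext
        change k.1.erase h = T.1
        rw [← Finset.sdiff_singleton_eq_erase, ← hh, Finset.sdiff_sdiff_eq_self hT]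
      have hsum : ∑ k', codedTerm e d h F i k' = ∑ k', codedTerm e d h F' i k' :=
        zmodToBit_injective (congrFun (hm h hk) (.inl i))
      have hother : ∑ k' ∈ Finset.univ.erase k, codedTerm e d h F i k' =
          ∑ k' ∈ Finset.univ.erase k, codedTerm e d h F' i k' := by
        refine Finset.sum_congr rfl fun k' hk' => ?_
        unfold codedTerm
        split_ifs with hhk'
        · rw [hc1]
          -- If `k' \ {h} ⊆ k`, then `h ∈ k` gives `k' ⊆ k`, and equal cardinalities force `k' = k`.
          intro hsub
          have hsub' : k'.1 ⊆ k.1 := by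
            rw [← Finset.insert_erase hhk']
            exact Finset.insert_subset hk hsub
          exact (Finset.mem_erase.1 hk').1
            (Subtype.ext (Finset.eq_of_subset_of_card_le hsub' (by rw [k.2, k'.2])))
        · rfl
      rw [← Finset.add_sum_erase _ _ (Finset.mem_univ k),
        ← Finset.add_sum_erase _ _ (Finset.mem_univ k), hother] at hsum
      have hterm := add_right_cancel hsum
      simp only [codedTerm, dif_pos hk, hTk] at hterm
      exact bitToZMod_injective hterm
    · exact hc1 _ T hT i
  -- The uncached part goes to every relay, so any one relay of `k` delivers it.
  · obtain ⟨h, hh⟩ : k.1.Nonempty := Finset.card_pos.1 (by rw [k.2]; omega)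
    exact congrFun (hm h hh) (.inr (d k, i))
  · exact hc2 _ i

end CodedDelivery

theorem card_user (H r : ℕ) : Fintype.card (User H r) = H.choose r := by
  rw [Fintype.card_finset_len, Fintype.card_fin]

theorem card_not_subset {H q : ℕ} (k : User H (q + 1)) :
    Fintype.card {T : User H q // ¬ T.1 ⊆ k.1} + (q + 1) = H.choose q := by
  have hsub : Fintype.card {T : User H q // T.1 ⊆ k.1} = q + 1 := by
    have hmap : (Finset.univ.filter fun T : User H q => T.1 ⊆ k.1).map
        (Function.Embedding.subtype _) = k.1.powersetCard q := by
      ext T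
      simp [Finset.mem_powersetCard, and_comm]
    rw [Fintype.card_subtype, ← Finset.card_map (Function.Embedding.subtype _), hmap,
      Finset.card_powersetCard, k.2, Nat.choose_succ_self_right]
  have hle := Fintype.card_subtype_le fun T : User H q => T.1 ⊆ k.1
  rw [Fintype.card_subtype_compl, card_user, hsub]
  rw [card_user, hsub] at hle
  exact Nat.sub_add_cancel hle

/-- Schemes without errors whenever the file splits into `H.choose q` pieces of length `a`, an
uncached part of length `s` and a part of length `c` that is cached by everybody. -/
theorem exists_zero_error_scheme {H q N B a s c : ℕ} (hB : B = H.choose q * a + (s + c)) :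
    ∃ S : Scheme H (q + 1) N B,
      (∀ k, S.cacheLen k + N * ((q + 1) * a) = N * (H.choose q * a + c)) ∧
      (∀ d h, S.serverLen d h = a + N * s) ∧
      (∀ d k h, S.relayLen d k h = a + N * s) ∧ ∀ d, S.errorProb d = 0 := by
  have hcard : Fintype.card (Fin B) =
      Fintype.card ((User H q × Fin a) ⊕ (Fin s ⊕ Fin c)) := by
    simp only [Fintype.card_sum, Fintype.card_prod, Fintype.card_fin, card_user]
    exact hB
  let e := Fintype.equivOfCardEq hcard
  refine ⟨Scheme.ofForwarding (codedCache e) (codedMsg e), fun k => ?_, fun d h => ?_,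
    fun d k h => ?_, fun d => Scheme.errorProb_eq_zero _ _ fun F k =>
      Scheme.ofForwarding_output _ _ d k (coded_determines e d k) F⟩
  · change Fintype.card (Fin N × CachedPos a c k) + _ = _
    rw [Fintype.card_prod, Fintype.card_sum, Fintype.card_prod, ← card_not_subset k]
    simp only [Fintype.card_fin]
    ring
  · change Fintype.card (Fin a ⊕ (Fin N × Fin s)) = _
    simp
  · change Fintype.card (Fin a ⊕ (Fin N × Fin s)) = _
    simp

/-- The scheme that stores and sends nothing. -/
theorem exists_empty_scheme (H r N B : ℕ) : ∃ S : Scheme H r N B,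
    (∀ k, S.cacheLen k = 0) ∧ (∀ d h, S.serverLen d h = 0) ∧ ∀ d k h, S.relayLen d k h = 0 :=
  ⟨Scheme.ofForwarding (ι := fun _ => Empty) (κ := Empty) (fun _ _ => Empty.elim)
    (fun _ _ _ => Empty.elim), fun _ => rfl, fun _ _ => rfl, fun _ _ _ => rfl⟩

/-! ### Achievability for all file lengths, with rounding -/

theorem achievable_of_lt {H q N : ℕ} {M R : ℝ} (hqH : q + 1 ≤ H) (hN : 1 ≤ N) (hMN : M ≤ N)
    (hM : (1 - M / N) * H.choose q ≤ q + 1) (hR : (1 - M / N) / (q + 1) < R) :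
    Achievable H (q + 1) N M R := by
  have hN0 : (0 : ℝ) < N := by exact_mod_cast hN
  have hq0 : (0 : ℝ) < (q : ℝ) + 1 := by positivity
  obtain ⟨u, hu⟩ : ∃ u : ℝ, u = 1 - M / N := ⟨_, rfl⟩
  rw [← hu] at hM hR
  have hu0 : 0 ≤ u := by
    have : M / N ≤ 1 := (div_le_one hN0).2 hMN
    linarith
  have hMu : M = N * (1 - u) := by rw [hu]; field_simp; ring
  have hCq : ((q : ℝ) + 1) ≤ H.choose q := by
    have h1 : (q + 1).choose q ≤ H.choose q := Nat.choose_le_choose q hqH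
    rw [Nat.choose_succ_self_right] at h1
    exact_mod_cast h1
  have hu1 : u ≤ 1 := by
    by_contra hlt
    nlinarith
  have hscheme : ∀ B : ℕ, ∃ S : Scheme H (q + 1) N B, S.CacheAtMost M ∧ S.MaxLinkLoadAtMost R ∧
      ((N : ℝ) * (q + 1) / (R - u / (q + 1)) ≤ B → ∀ d, S.errorProb d = 0) := by
    intro B
    have hB0 : (0 : ℝ) ≤ B := B.cast_nonneg
    by_cases hlarge : (N : ℝ) * (q + 1) / (R - u / (q + 1)) ≤ B
    · set a : ℕ := ⌊(B : ℝ) * u / (q + 1)⌋₊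
      have ha1 : (a : ℝ) ≤ B * u / (q + 1) := Nat.floor_le (by positivity)
      have ha2 : (B : ℝ) * u / (q + 1) < a + 1 := Nat.lt_floor_add_one _
      have ha1' : (a : ℝ) * (q + 1) ≤ B * u := (le_div_iff₀ hq0).1 ha1
      have ha2' : (B : ℝ) * u < (a + 1) * (q + 1) := (div_lt_iff₀ hq0).1 ha2
      have hCa' : (H.choose q : ℝ) * a ≤ B := by
        have h1 : (H.choose q : ℝ) * (a * (q + 1)) ≤ B * (q + 1) :=
          calc (H.choose q : ℝ) * (a * (q + 1)) ≤ H.choose q * (B * u) := by gcongr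
            _ = B * (u * H.choose q) := by ring
            _ ≤ B * (q + 1) := by gcongr
        nlinarith
      have hCa : H.choose q * a ≤ B := by exact_mod_cast hCa'
      -- Rounding `a` down shrinks the missing part of a file by less than `q + 1` bits. Leaving `q
      -- + 1` further bits uncached restores the cache bound, at a load of at most `N * (q + 1)`
      -- bits, which the slack in `R` absorbs for large `B`. If fewer bits remain, none are cached
      -- and `hM` gives the bound.
      obtain ⟨s, c, hsc, hs, hcase⟩ : ∃ s c, B = H.choose q * a + (s + c) ∧ s ≤ q + 1 ∧
          (s = q + 1 ∨ c = 0) := by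
        by_cases hle : q + 1 ≤ B - H.choose q * a
        · exact ⟨q + 1, B - H.choose q * a - (q + 1), by omega, le_rfl, .inl rfl⟩
        · exact ⟨B - H.choose q * a, 0, by omega, by omega, .inr rfl⟩
      obtain ⟨S, hS1, hS2, hS3, hS4⟩ := exists_zero_error_scheme (N := N) hsc
      have hload : ((a + N * s : ℕ) : ℝ) ≤ R * B := by
        have h1 : (N : ℝ) * (q + 1) ≤ B * (R - u / (q + 1)) :=
          (div_le_iff₀ (by linarith)).1 hlarge
        have h2 : (N : ℝ) * s ≤ N * (q + 1) := by
          gcongr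
          exact_mod_cast hs
        have h3 : (B : ℝ) * u / (q + 1) = B * (u / (q + 1)) := by ring
        push_cast
        linarith
      refine ⟨S, fun k => ?_, fun d => ⟨fun h => by rw [hS2]; exact hload,
        fun k h => by rw [hS3]; exact hload⟩, fun _ => hS4⟩
      have h1 : (S.cacheLen k : ℝ) + N * ((q + 1) * a) = N * (H.choose q * a + c) := by
        exact_mod_cast hS1 k
      have h2 : (B : ℝ) = H.choose q * a + (s + c) := by exact_mod_cast hsc
      have h3 : (H.choose q : ℝ) * a + c - (q + 1) * a ≤ (1 - u) * B := by
        rcases hcase with rfl | rfl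
        · push_cast at h2
          linarith
        · have h4 : (H.choose q - (q + 1) : ℝ) * (a * (q + 1)) ≤ (1 - u) * B * (q + 1) :=
            calc (H.choose q - (q + 1) : ℝ) * (a * (q + 1))
                ≤ (H.choose q - (q + 1) : ℝ) * (B * u) := by
                  gcongr
              _ = B * (u * H.choose q) - B * u * (q + 1) := by ring
              _ ≤ B * (q + 1) - B * u * (q + 1) := by gcongr
              _ = (1 - u) * B * (q + 1) := by ring
          rw [← mul_assoc] at h4
          have h5 := le_of_mul_le_mul_right h4 hq0
          rw [Nat.cast_zero]
          linarith
      have h6 := mul_le_mul_of_nonneg_left h3 hN0.le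
      rw [hMu]
      linarith
    -- For small `B` only the size limits matter, since errors count only in the limit.
    · obtain ⟨S, hS1, hS2, hS3⟩ := exists_empty_scheme H (q + 1) N B
      have hR0 : 0 ≤ R := le_trans (by positivity) hR.le
      have hM0 : 0 ≤ M := hMu ▸ mul_nonneg hN0.le (by linarith)
      refine ⟨S, fun k => ?_, fun d => ⟨fun h => ?_, fun k h => ?_⟩, fun h => absurd h hlarge⟩
      · rw [hS1, Nat.cast_zero]; positivity
      · rw [hS2, Nat.cast_zero]; positivity
      · rw [hS3, Nat.cast_zero]; positivity
  choose S hS1 hS2 hS3 using hscheme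
  refine ⟨S, hS1, hS2, fun d => tendsto_const_nhds.congr' ?_⟩
  filter_upwards [tendsto_natCast_atTop_atTop.eventually_ge_atTop
    ((N : ℝ) * (q + 1) / (R - u / (q + 1)))] with B hB
  exact (hS3 B hB d).symm

/-! ### Converse: the cut-set bound -/

/-- A user that recovers every file from its cache and from the messages for `N` demand vectors
must have received enough bits. -/
theorem card_correct_le {H r N B : ℕ} (S : Scheme H r N B) (k : User H r)
    (d : Fin N → Demand H r N) (G : Finset (Library N B))
    (hG : ∀ F ∈ G, ∀ n, S.output (d n) F k = F n) :
    G.card ≤ 2 ^ (S.cacheLen k + ∑ n, ∑ h, S.relayLen (d n) k h) := by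
  let view : Library N B → Bits (S.cacheLen k) ×
      ((n : Fin N) → (h : RelayOf k) → Bits (S.relayLen (d n) k h)) :=
    fun F => (S.cache k F, fun n h => S.relayMsg (d n) k h (S.serverMsg (d n) h.1 F))
  have hinj : Set.InjOn view G := by
    intro F hF F' hF' hview
    funext n
    rw [← hG F hF n, ← hG F' hF' n]
    have h1 := congrArg Prod.fst hview
    have h2 := congrFun (congrArg Prod.snd hview) n
    simp only [view] at h1 h2
    unfold Scheme.output
    rw [h1, h2]
  calc G.card ≤ (Finset.univ : Finset (Bits (S.cacheLen k) ×
      ((n : Fin N) → (h : RelayOf k) → Bits (S.relayLen (d n) k h)))).card :=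
        Finset.card_le_card_of_injOn view (fun _ _ => Finset.mem_coe.2 (Finset.mem_univ _)) hinj
    _ = _ := by
        simp [Finset.card_univ, Fintype.card_pi, pow_add, Finset.prod_pow_eq_pow_sum]

theorem card_library (N B : ℕ) : Fintype.card (Library N B) = 2 ^ (N * B) := by
  simp [Fintype.card_pi, ← pow_mul, mul_comm]

/-- By the union bound at least half of the libraries are decoded correctly under all constant
demands; the halving costs the one bit in the bound. -/
theorem le_load_of_sum_errorProb_le {H r N B : ℕ} {M R : ℝ} (S : Scheme H r N B) (k : User H r)
    (hS : S.CacheAtMost M) (hL : S.MaxLinkLoadAtMost R)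
    (herr : ∑ n : Fin N, S.errorProb (fun _ => n) ≤ 1 / 2) :
    (N * B : ℝ) ≤ 1 + M * B + N * (r * (R * B)) := by
  classical
  let bad : Fin N → Finset (Library N B) := fun n =>
    Finset.univ.filter fun F => ∃ k, S.output (fun _ => n) F k ≠ F n
  let G : Finset (Library N B) := (Finset.univ.biUnion bad)ᶜ
  have hG : ∀ F ∈ G, ∀ n, S.output (fun _ => n) F k = F n := by
    intro F hF n
    by_contra hne
    exact (Finset.mem_compl.1 hF) (Finset.mem_biUnion.2
      ⟨n, Finset.mem_univ _, Finset.mem_filter.2 ⟨Finset.mem_univ _, k, hne⟩⟩)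
  have hle := card_correct_le S k (fun n _ => n) G hG
  have hpos : (0 : ℝ) < 2 ^ (N * B) := by positivity
  have hbad : (∑ n, ((bad n).card : ℝ)) ≤ 2 ^ (N * B) / 2 := by
    have hEq : ∀ n : Fin N, S.errorProb (fun _ => n) = (bad n).card / 2 ^ (N * B) := by
      intro n
      unfold Scheme.errorProb
      rw [card_library]
      push_cast
      congr!
    simp only [hEq, ← Finset.sum_div] at herr
    rw [div_le_iff₀ hpos] at herr
    linarith
  have hGcard : (2 : ℝ) ^ (N * B) ≤ 2 * G.card := by
    have h1 : G.card + (Finset.univ.biUnion bad).card = 2 ^ (N * B) := by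
      rw [add_comm, Finset.card_add_card_compl, card_library]
    have h2 : (G.card : ℝ) + (Finset.univ.biUnion bad).card = 2 ^ (N * B) := by exact_mod_cast h1
    have h3 : ((Finset.univ.biUnion bad).card : ℝ) ≤ ∑ n, ((bad n).card : ℝ) := by
      exact_mod_cast Finset.card_biUnion_le
    linarith
  have hexp : N * B ≤ 1 + (S.cacheLen k + ∑ n : Fin N, ∑ h, S.relayLen (fun _ => n) k h) := by
    have h1 : 2 ^ (N * B) ≤ 2 * G.card := by exact_mod_cast hGcard
    refine (Nat.pow_le_pow_iff_right (a := 2) (by norm_num)).1 ?_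
    rw [pow_add, pow_one]
    exact h1.trans (Nat.mul_le_mul_left 2 hle)
  have hsum : (∑ n : Fin N, ∑ h, (S.relayLen (fun _ => n) k h : ℝ)) ≤ N * (r * (R * B)) :=
    calc (∑ n : Fin N, ∑ h, (S.relayLen (fun _ => n) k h : ℝ))
        ≤ ∑ _n : Fin N, ∑ _h : RelayOf k, R * B :=
          Finset.sum_le_sum fun n _ => Finset.sum_le_sum fun h _ => (hL _).2 k h
      _ = N * (r * (R * B)) := by simp [k.2]
  have hexp' : (N * B : ℝ) ≤
      1 + (S.cacheLen k + ∑ n : Fin N, ∑ h, (S.relayLen (fun _ => n) k h : ℝ)) := by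
    exact_mod_cast hexp
  linarith [hS k]

/-- The cut-set bound for a single user. -/
theorem Achievable.cut_set {H r N : ℕ} {M R : ℝ} (hrH : r ≤ H) (h : Achievable H r N M R) :
    (N : ℝ) ≤ M + N * (r * R) := by
  obtain ⟨S, hS, hL, herr⟩ := h
  obtain ⟨k, -, hk⟩ := Finset.exists_subset_card_eq
    (show r ≤ (Finset.univ : Finset (Fin H)).card by simpa using hrH)
  have hlim : Filter.Tendsto (fun B => ∑ n : Fin N, (S B).errorProb (fun _ => n))
      Filter.atTop (nhds 0) := by
    simpa using tendsto_finsetSum (Finset.univ : Finset (Fin N)) fun n _ => herr fun _ => n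
  have hev := hlim.eventually (Iic_mem_nhds (show (0 : ℝ) < 1 / 2 by norm_num))
  by_contra hlt
  push Not at hlt
  -- For such `B` the supposed gap, multiplied by `B`, exceeds that one bit.
  obtain ⟨B, hB, hBlarge⟩ := (hev.and (tendsto_natCast_atTop_atTop.eventually_gt_atTop
    (1 / (N - (M + N * (r * R)))))).exists
  have h1 := le_load_of_sum_errorProb_le (S B) ⟨k, hk⟩ (hS B) (hL B) hB
  rw [div_lt_iff₀ (by linarith)] at hBlarge
  linarith

end CombinationNetwork

open CombinationNetwork in
theorem mainTheorem2 (H r N : ℕ) (hr : 1 ≤ r) (hrH : r ≤ H) (hN : 1 ≤ N) (M : ℝ)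
    (hM : ((H.choose r : ℝ) - H + r - 1) * N / (H.choose r : ℝ) ≤ M) (hMN : M ≤ N) :
    CombinationNetwork.IsOptimalMaxLinkLoad H r N M ((1 - M / N) / r) := by
  have hN0 : (0 : ℝ) < N := by exact_mod_cast hN
  obtain ⟨q, rfl⟩ : ∃ q, r = q + 1 := ⟨r - 1, by omega⟩
  have hq0 : (0 : ℝ) < (q : ℝ) + 1 := by positivity
  constructor
  · intro R hR
    have h1 := Achievable.cut_set hrH hR
    push_cast at h1 ⊢
    rw [div_le_iff₀ hq0, sub_le_iff_le_add, ← sub_le_iff_le_add', le_div_iff₀ hN0]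
    linarith
  · intro b hb
    -- Only loads strictly above the optimum are shown achievable, which is enough for the infimum.
    refine le_of_forall_gt_imp_ge_of_dense fun R hR => hb (achievable_of_lt hrH hN hMN ?_ ?_)
    · have hK0 : (0 : ℝ) < H.choose (q + 1) := by exact_mod_cast Nat.choose_pos hrH
      -- This identity turns the threshold `u * K ≤ H - q` into `u * H.choose q ≤ q + 1`.
      have hKC : (H.choose (q + 1) : ℝ) * (q + 1) = H.choose q * (H - q) := by
        rw [← Nat.cast_sub (show q ≤ H by omega)]
        exact_mod_cast Nat.choose_succ_right_eq H q
      have hHq : (0 : ℝ) < H - q := by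
        have : ((q + 1 : ℕ) : ℝ) ≤ H := by exact_mod_cast hrH
        push_cast at this
        linarith
      have hu : (1 - M / N) * H.choose (q + 1) ≤ H - q := by
        rw [div_le_iff₀ hK0, ← le_div_iff₀ hN0, mul_div_right_comm] at hM
        push_cast at hM
        linarith
      have h1 : (1 - M / N) * H.choose q * (H - q) ≤ (q + 1) * (H - q) :=
        calc (1 - M / N) * H.choose q * (H - q)
            = (1 - M / N) * H.choose (q + 1) * (q + 1) := by rw [mul_assoc, ← hKC, mul_assoc]
          _ ≤ (H - q) * (q + 1) := by gcongr
          _ = (q + 1) * (H - q) := by ring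
      exact le_of_mul_le_mul_right h1 hHq
    · simpa using hR
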